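/- Let $X$ be a finite set with $|X|=m$, let $\mathcal L$ be the set of linear orders (preferences) on $X$, and let $\Delta(\mathcal L)$ be the set of probability distributions on $\mathcal L$. Two distributions $\mu,\nu\in\Delta(\mathcal L)$ are observationally equivalent if for all $x\in A\subseteq X$ the set of preferences under which $x$ is the best element of $A$ has the same probability under $\mu$ and under $\nu$. A set $\mathcal M\subseteq\Delta(\mathcal L)$ is identifying if it contains no two distinct observationally equivalent distributions. The support restriction defined by $\mathcal S\subseteq\mathcal L$ is $\{\mu\in\Delta(\mathcal L):\operatorname{supp}(\mu)\subseteq\mathcal S\}$. Let $\succ_1,\dots,\succ_N$ be a finite sequence of preferences, repetition allowed, and let $x^k_n$ be the $k$-th best alternative of $\succ_n$. A rearrangement of the sequence is a family of permutations $\sigma_1,\dots,\sigma_m$ of $\{1,\dots,N\}$ such that, for all $k$ and $i$, the preferences $\succ_i$ and $\succ_{\sigma_k(i)}$ have the same set of $k-1$ best alternatives. The sequence $\succ'_1,\dots,\succ'_N$ is rearrangement equivalent to $\succ_1,\dots,\succ_N$ if there is a rearrangement such that, for all $n$ and $k$, the $k$-th best alternative of $\succ'_n$ is $x^k_{j}$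 with $j=(\sigma_1\circ\sigma_2\circ\cdots\circ\sigma_k)^{-1}(n)$ (maps composed from right to left). Two sequences of the same length are called distinct if neither is a reordering of the other, i.e. if some preference occurs a different number of times in the two. Then, for every $\mathcal S\subseteq\mathcal L$, the support restriction defined by $\mathcal S$ is identifying if and only if there is no pair of distinct, rearrangement-equivalent sequences all of whose entries lie in $\mathcal S$. -/

import Mathlib

namespace RandomUtility

/-- A preference on `X`: a complete, transitive and antisymmetric binary relation
(`p.1 x y` reads: `x` is weakly preferred to `y`). -/
def Preference (X : Type*) : Type _ := {r : X → X → Prop // IsLinearOrder X r}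

instance (X : Type*) [Fintype X] : Finite (Preference X) :=
  inferInstanceAs (Finite {r : X → X → Prop // IsLinearOrder X r})

noncomputable instance (X : Type*) [Fintype X] : Fintype (Preference X) := Fintype.ofFinite _

variable {X : Type*} [Fintype X]

/-! ### Distributions over preferences and choice frequencies -/

/-- `x` is the best alternative of the menu `A`. -/
def IsBest (p : Preference X) (x : X) (A : Finset X) : Prop := x ∈ A ∧ ∀ y ∈ A, p.1 x y

open Classical in
/-- The probability that `x` is chosen from `A` when preferences are drawn according to `μ`. -/
noncomputable def choiceProb (μ : Preference X → ℝ) (x : X) (A : Finset X) : ℝ :=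
  ∑ p : Preference X, if IsBest p x A then μ p else 0

/-- Two distributions generate the same choice frequencies on every menu. -/
def ObsEquiv (μ ν : Preference X → ℝ) : Prop :=
  ∀ (A : Finset X), ∀ x ∈ A, choiceProb μ x A = choiceProb ν x A

/-- A set of distributions is identifying if it contains no two distinct observationally
equivalent elements. -/
def IsIdentifying (M : Set (Preference X → ℝ)) : Prop :=
  ¬ ∃ μ ∈ M, ∃ ν ∈ M, μ ≠ ν ∧ ObsEquiv μ ν

/-- The support restriction given by `S`: all probability distributions over preferences
whose support is contained in `S`. -/
def supportRestriction (S : Set (Preference X)) : Set (Preference X → ℝ) :=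
  {μ | μ ∈ stdSimplex ℝ (Preference X) ∧ Function.support μ ⊆ S}

/-! ### Ranks, compatibility and rearrangements

Positions are counted from `0`: position `k : Fin (Fintype.card X)` is the `(k+1)`-st best. -/

open Classical in
/-- The number of alternatives strictly better than `x`. -/
noncomputable def rank (p : Preference X) (x : X) : ℕ :=
  (Finset.univ.filter fun y => y ≠ x ∧ p.1 y x).card

theorem rank_lt_card (p : Preference X) (x : X) : rank p x < Fintype.card X := by
  classical
  unfold rank
  refine Finset.card_lt_univ_of_notMem (x := x) ?_
  simp

theorem rank_lt_of_rel (p : Preference X) {x y : X} (h : p.1 x y) (hne : x ≠ y) :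
    rank p x < rank p y := by
  classical
  have := p.2
  unfold rank
  apply Finset.card_lt_card
  rw [Finset.ssubset_iff_of_subset]
  · exact ⟨x, by simp [h, hne], by simp⟩
  · intro z hz
    simp only [Finset.mem_filter, Finset.mem_univ, true_and] at hz ⊢
    refine ⟨?_, _root_.trans hz.2 h⟩
    rintro rfl
    exact hz.1 (antisymm hz.2 h)

theorem rank_bijective (p : Preference X) :
    Function.Bijective
      (fun x => (⟨rank p x, rank_lt_card p x⟩ : Fin (Fintype.card X))) := by
  refine (Fintype.bijective_iff_injective_and_card _).2 ⟨?_, by simp⟩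
  intro x y h
  have := p.2
  by_contra hne
  have h' : rank p x = rank p y := by simpa using h
  rcases total_of p.1 x y with h1 | h1
  · exact absurd h' (rank_lt_of_rel p h1 hne).ne
  · exact absurd h' (rank_lt_of_rel p h1 (Ne.symm hne)).ne'

/-- The alternative at position `k`, counted from `0`, in the preference `p`. -/
noncomputable def nthBest (p : Preference X) (k : Fin (Fintype.card X)) : X :=
  (Equiv.ofBijective _ (rank_bijective p)).symm k

/-- `p` and `q` are `k`-compatible: they have the same set of `k` best alternatives. -/
def Compatible (k : ℕ) (p q : Preference X) : Prop :=
  {x | rank p x < k} = {x | rank q x < k}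

/-- A rearrangement of the sequence `p`: for each position `k`, counted from `0`, a permutation of
the indices which preserves each class of indices whose preferences share the set of `k` best
alternatives. -/
def IsRearrangement {N : ℕ} (p : Fin N → Preference X)
    (σ : Fin (Fintype.card X) → Equiv.Perm (Fin N)) : Prop :=
  ∀ (k : Fin (Fintype.card X)) (i : Fin N), Compatible (k : ℕ) (p i) (p (σ k i))

/-- `q` is obtained from `p` by a rearrangement `σ`: the alternative at position `k` of the `n`-th
entry of `q` is the one at position `k` of entry `(σ 0 ∘ ⋯ ∘ σ k)⁻¹ n` of `p`.
(`Fin.partialProd σ k.succ` is the product `σ 0 * ⋯ * σ k`.) Thus the source index at position `k`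
is the image under `(σ k)⁻¹` of the one at position `k - 1`, so that each string passes from one
entry of `p` only to an entry with the same set of better alternatives. -/
def RearrangementEquivalent {N : ℕ} (p q : Fin N → Preference X) : Prop :=
  ∃ σ : Fin (Fintype.card X) → Equiv.Perm (Fin N), IsRearrangement p σ ∧
    ∀ (n : Fin N) (k : Fin (Fintype.card X)),
      nthBest (q n) k = nthBest (p ((Fin.partialProd σ k.succ)⁻¹ n)) k

/-- The two sequences consist of the same preferences with the same multiplicities, i.e. they
differ only in the order in which their entries are listed. -/
def SameUpToOrder {N : ℕ} (p q : Fin N → Preference X) : Prop :=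
  ∃ π : Equiv.Perm (Fin N), ∀ n, q n = p (π n)

end RandomUtility

/-!
Both sides are translated into a statement about the numbers `m(C, x)`: the mass of the preferences
for which `C` is exactly the set of alternatives better than `x`.

* `x` is best in `A` iff the set of alternatives better than `x` is contained in `Aᶜ`. Hence choice
  frequencies are the sums of `m(·, x)` over the subsets of `Aᶜ`, and by Möbius inversion
  (`eq_of_sum_powerset_eq`) equal choice frequencies mean equal `m(C, x)` for all `C` and `x`.
* If `q` arises from `p` by a rearrangement, then for each position `k` the source index is a
  permutation `τ k` of the indices, and compatibility gives, by induction on `k`, that `q n` and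
  `p (τ k n)` have the same `k` best alternatives and the same next one. So `m` agrees for `p` and
  `q`. Conversely, if `m` agrees, such permutations `τ k` exist, and
  `σ k = τ (k - 1) * (τ k)⁻¹` is a rearrangement from `p` to `q`
  (`rearrangementEquivalent_iff`).

So two sequences are rearrangement equivalent iff their empirical distributions are observationally
equivalent (`rearrangementEquivalent_iff_count_isBest`), and it remains to pass from two distinct
observationally equivalent real distributions to two distinct sequences with the same choice counts.
Their difference solves a homogeneous linear system with integer coefficients. Applying a
`ℚ`-linear functional `ℝ → ℚ` that does not kill it, and clearing denominators, produces a nonzero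
integer solution with no larger support (`exists_int_of_real`). The multiplicities of the two
sequences are its positive and its negative part.
-/

namespace RandomUtility

variable {X : Type*} [Fintype X]

/-! ### The set of alternatives better than a given one -/

open Classical in
/-- The set of alternatives strictly better than `x`. -/
noncomputable def upper (p : Preference X) (x : X) : Finset X :=
  Finset.univ.filter fun y => y ≠ x ∧ p.1 y x

theorem card_upper (p : Preference X) (x : X) : (upper p x).card = rank p x := rfl

theorem self_notMem_upper (p : Preference X) (x : X) : x ∉ upper p x := by
  simp [upper]

theorem mem_upper_iff_rank_lt (p : Preference X) (x y : X) :
    y ∈ upper p x ↔ rank p y < rank p x := by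
  have := p.2
  simp only [upper, Finset.mem_filter, Finset.mem_univ, true_and]
  constructor
  · rintro ⟨h, h'⟩
    exact rank_lt_of_rel p h' h
  · intro h
    have hne : y ≠ x := by rintro rfl; exact lt_irrefl _ h
    refine ⟨hne, ?_⟩
    rcases total_of p.1 y x with h1 | h1
    · exact h1
    · exact absurd (rank_lt_of_rel p h1 hne.symm) (by omega)

open Classical in
theorem isBest_iff_upper_subset_compl (p : Preference X) (x : X) (A : Finset X) :
    IsBest p x A ↔ x ∈ A ∧ upper p x ⊆ Aᶜ := by
  have := p.2
  refine and_congr_right fun hx => ?_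
  simp only [Finset.subset_iff, Finset.mem_compl, mem_upper_iff_rank_lt]
  constructor
  · intro h y hy hyA
    by_cases hne : x = y
    · subst hne; exact lt_irrefl _ hy
    · exact absurd (rank_lt_of_rel p (h y hyA) hne) (by omega)
  · intro h y hy
    by_contra hxy
    have hne : y ≠ x := by rintro rfl; exact hxy (refl_of p.1 y)
    exact h (rank_lt_of_rel p ((total_of p.1 x y).resolve_left hxy) hne) hy

theorem rank_nthBest (p : Preference X) (k : Fin (Fintype.card X)) :
    rank p (nthBest p k) = k :=
  congrArg Fin.val ((Equiv.ofBijective _ (rank_bijective p)).apply_symm_apply k)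

theorem eq_nthBest_iff (p : Preference X) (k : Fin (Fintype.card X)) (x : X) :
    x = nthBest p k ↔ rank p x = k := by
  constructor
  · rintro rfl
    exact rank_nthBest p k
  · intro h
    exact (rank_bijective p).1 (Fin.ext (h.trans (rank_nthBest p k).symm))

theorem mem_upper_nthBest (p : Preference X) (k : Fin (Fintype.card X)) (y : X) :
    y ∈ upper p (nthBest p k) ↔ rank p y < k := by
  rw [mem_upper_iff_rank_lt, rank_nthBest]

theorem compatible_iff_upper_eq (p q : Preference X) (k : Fin (Fintype.card X)) :
    Compatible k p q ↔ upper p (nthBest p k) = upper q (nthBest q k) := by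
  simp [Compatible, Set.ext_iff, Finset.ext_iff, mem_upper_nthBest]

theorem compatible_succ {p q : Preference X} {k : Fin (Fintype.card X)}
    (h : Compatible k p q) (h' : nthBest p k = nthBest q k) : Compatible (k + 1) p q := by
  simp only [Compatible, Set.ext_iff, Set.mem_ofPred_eq] at h ⊢
  intro x
  rw [Nat.lt_succ_iff_lt_or_eq, Nat.lt_succ_iff_lt_or_eq, h x, ← eq_nthBest_iff,
    ← eq_nthBest_iff, h']

theorem upper_eq_iff {p : Preference X} {x : X} {C : Finset X} {k : Fin (Fintype.card X)}
    (hk : C.card = k) : upper p x = C ↔ upper p (nthBest p k) = C ∧ nthBest p k = x := by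
  constructor
  · rintro rfl
    have : x = nthBest p k := (eq_nthBest_iff p k x).2 (by rw [← card_upper, hk])
    exact ⟨by rw [← this], this.symm⟩
  · rintro ⟨h, rfl⟩
    exact h

/-! ### Rearrangements and the numbers of preferences with a given better set -/

/-- Two finite families with equally large fibres differ by a permutation of the index set. -/
theorem exists_perm_of_card_fiber_eq {ι α : Type*} [Fintype ι] [DecidableEq α] (f g : ι → α)
    (h : ∀ a, (Finset.univ.filter fun i => f i = a).card =
      (Finset.univ.filter fun i => g i = a).card) :
    ∃ τ : Equiv.Perm ι, ∀ i, f i = g (τ i) := by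
  have e : ∀ a, Nonempty ({i // f i = a} ≃ {i // g i = a}) := fun a =>
    Fintype.card_eq.1 (by rw [Fintype.card_subtype, Fintype.card_subtype, h a])
  refine ⟨(Equiv.sigmaFiberEquiv f).symm.trans
    ((Equiv.sigmaCongrRight fun a => (e a).some).trans (Equiv.sigmaFiberEquiv g)), fun i => ((e (f i)).some ⟨i, rfl⟩).2.symm⟩

variable {N : ℕ}

open Classical in
/-- The number of entries of the sequence `p` satisfying `P`. -/
noncomputable def count (p : Fin N → Preference X) (P : Preference X → Prop) : ℕ :=
  (Finset.univ.filter fun n => P (p n)).card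

omit [Fintype X] in
theorem count_eq_of_perm {p q : Fin N → Preference X} {P : Preference X → Prop}
    (τ : Equiv.Perm (Fin N)) (h : ∀ n, P (q n) ↔ P (p (τ n))) : count p P = count q P := by
  classical
  refine (Finset.card_equiv τ fun n => ?_).symm
  simp [h]

/-- By a rearrangement, each entry of the new sequence gets its `k` best alternatives and the one
at position `k` from an entry of the old sequence that ranks the same alternatives there. -/
theorem compatible_of_isRearrangement {p q : Fin N → Preference X}
    {σ : Fin (Fintype.card X) → Equiv.Perm (Fin N)} (hσ : IsRearrangement p σ)
    (hq : ∀ (n : Fin N) (k : Fin (Fintype.card X)),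
      nthBest (q n) k = nthBest (p ((Fin.partialProd σ k.succ)⁻¹ n)) k) (n : Fin N) :
    ∀ (k : ℕ) (hk : k < Fintype.card X),
      Compatible k (q n) (p ((Fin.partialProd σ (Fin.succ ⟨k, hk⟩))⁻¹ n)) := by
  intro k
  induction k with
  | zero => intro hk; simp [Compatible]
  | succ k ih =>
    intro hk
    have h1 := compatible_succ (k := ⟨k, by omega⟩) (ih (by omega)) (hq n ⟨k, by omega⟩)
    have h2 := hσ ⟨k + 1, hk⟩ ((Fin.partialProd σ (Fin.succ ⟨k + 1, hk⟩))⁻¹ n)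
    have h3 : σ ⟨k + 1, hk⟩ ((Fin.partialProd σ (Fin.succ ⟨k + 1, hk⟩))⁻¹ n) =
        (Fin.partialProd σ (Fin.succ ⟨k, by omega⟩))⁻¹ n := by
      rw [Fin.partialProd_succ, mul_inv_rev, ← Equiv.Perm.mul_apply, mul_inv_cancel_left]
      rfl
    rw [h3] at h2
    exact Eq.trans h1 (Eq.symm h2)

theorem rearrangementEquivalent_iff (p q : Fin N → Preference X) :
    RearrangementEquivalent p q ↔
      ∀ (C : Finset X) (x : X), count p (upper · x = C) = count q (upper · x = C) := by
  classical
  constructor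
  · rintro ⟨σ, hσ, hq⟩ C x
    by_cases hC : C.card < Fintype.card X
    · refine count_eq_of_perm (Fin.partialProd σ (Fin.succ ⟨C.card, hC⟩))⁻¹ fun n => ?_
      have hc := (compatible_iff_upper_eq _ _ ⟨C.card, hC⟩).1
        (compatible_of_isRearrangement hσ hq n C.card hC)
      rw [upper_eq_iff (p := q n) (k := ⟨C.card, hC⟩) rfl, hc, hq, ← upper_eq_iff rfl]
    · have h0 : ∀ r : Preference X, upper r x ≠ C := by
        rintro r rfl
        exact hC (by rw [card_upper]; exact rank_lt_card r x)
      simp [count, h0]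
  · intro h
    have hτ : ∀ k : Fin (Fintype.card X), ∃ τ : Equiv.Perm (Fin N), ∀ n,
        (upper (q n) (nthBest (q n) k), nthBest (q n) k) =
          (upper (p (τ n)) (nthBest (p (τ n)) k), nthBest (p (τ n)) k) := by
      intro k
      refine exists_perm_of_card_fiber_eq
        (fun n => (upper (q n) (nthBest (q n) k), nthBest (q n) k))
        (fun n => (upper (p n) (nthBest (p n) k), nthBest (p n) k)) ?_
      rintro ⟨C, x⟩
      simp only [Prod.mk.injEq]
      by_cases hC : C.card = k
      · simp only [← upper_eq_iff hC]
        have := h C x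
        simp only [count] at this
        convert this.symm
      · have h0 : ∀ r : Preference X, upper r (nthBest r k) ≠ C := by
          rintro r rfl
          exact hC (by rw [card_upper, rank_nthBest])
        simp [h0]
    choose τ hτ using hτ
    have hup : ∀ (k : Fin (Fintype.card X)) n, Compatible k (q n) (p (τ k n)) := fun k n =>
      (compatible_iff_upper_eq _ _ k).2 (Prod.ext_iff.1 (hτ k n)).1
    have hbest : ∀ k n, nthBest (q n) k = nthBest (p (τ k n)) k := fun k n =>
      (Prod.ext_iff.1 (hτ k n)).2
    -- The partial products are prescribed to be `1` and the inverses of the `τ k`.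
    let T : Fin (Fintype.card X + 1) → Equiv.Perm (Fin N) := Fin.cons 1 fun k => (τ k)⁻¹
    have hTs : ∀ k, T k.succ = (τ k)⁻¹ := fun k => by simp [T]
    let σ : Fin (Fintype.card X) → Equiv.Perm (Fin N) :=
      fun k => (T k.castSucc)⁻¹ * T k.succ
    have hT : ∀ k, Fin.partialProd σ k = T k := by
      intro k
      have := congrFun (Fin.partialProd_left_inv T) k
      simpa [T, σ] using this
    refine ⟨σ, ?_, ?_⟩
    · rintro ⟨k, hk⟩ i
      obtain ⟨n, rfl⟩ := (τ ⟨k, hk⟩).surjective i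
      cases k with
      | zero => simp [Compatible]
      | succ k =>
        have hσ : σ ⟨k + 1, hk⟩ (τ ⟨k + 1, hk⟩ n) = τ ⟨k, by omega⟩ n := by
          have hc : T (⟨k + 1, hk⟩ : Fin (Fintype.card X)).castSucc = (τ ⟨k, by omega⟩)⁻¹ :=
            hTs ⟨k, by omega⟩
          simp only [σ, hc, hTs, inv_inv, Equiv.Perm.mul_apply]
          rw [← Equiv.Perm.mul_apply (τ ⟨k + 1, hk⟩)⁻¹, inv_mul_cancel, Equiv.Perm.one_apply]
        rw [hσ]
        exact Eq.trans (Eq.symm (hup ⟨k + 1, hk⟩ n))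
          (compatible_succ (hup ⟨k, by omega⟩ n) (hbest ⟨k, by omega⟩ n))
    · intro n k
      rw [hT, hTs, inv_inv]
      exact hbest k n

/-! ### Möbius inversion -/

/-- Sums over the subsets of the sets in a family closed under subsets determine the summands on
that family. -/
theorem eq_of_sum_powerset_eq {α : Type*} {f g : Finset α → ℕ} {D : Finset α → Prop}
    (hD : ∀ ⦃B C⦄, B ⊆ C → D C → D B)
    (h : ∀ C, D C → ∑ B ∈ C.powerset, f B = ∑ B ∈ C.powerset, g B) (C : Finset α) (hC : D C) :
    f C = g C := by
  classical
  induction C using Finset.strongInduction with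
  | H C ih =>
    have h1 := h C hC
    rw [← Finset.add_sum_erase _ _ (Finset.mem_powerset_self C),
      ← Finset.add_sum_erase _ g (Finset.mem_powerset_self C)] at h1
    have h2 : ∑ B ∈ C.powerset.erase C, f B = ∑ B ∈ C.powerset.erase C, g B := by
      refine Finset.sum_congr rfl fun B hB => ?_
      rw [Finset.mem_erase, Finset.mem_powerset] at hB
      exact ih B (hB.2.ssubset_of_ne hB.1) (hD hB.2 hC)
    omega

open Classical in
theorem count_isBest (p : Fin N → Preference X) {x : X} {A : Finset X} (hx : x ∈ A) :
    count p (IsBest · x A) = ∑ C ∈ (Aᶜ).powerset, count p (upper · x = C) := by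
  unfold count
  rw [Finset.card_eq_sum_card_fiberwise (f := fun n => upper (p n) x) (t := (Aᶜ).powerset)]
  · refine Finset.sum_congr rfl fun C hC => ?_
    congr 1
    ext n
    simp only [Finset.mem_filter, Finset.mem_univ, true_and, isBest_iff_upper_subset_compl, hx,
      and_iff_right_iff_imp]
    rintro rfl
    exact Finset.mem_powerset.1 hC
  · intro n hn
    have hb : IsBest (p n) x A := (Finset.mem_filter.1 hn).2
    exact Finset.mem_coe.2
      (Finset.mem_powerset.2 ((isBest_iff_upper_subset_compl _ _ _).1 hb).2)

theorem rearrangementEquivalent_iff_count_isBest (p q : Fin N → Preference X) :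
    RearrangementEquivalent p q ↔
      ∀ (A : Finset X), ∀ x ∈ A, count p (IsBest · x A) = count q (IsBest · x A) := by
  classical
  rw [rearrangementEquivalent_iff]
  constructor
  · intro h A x hx
    rw [count_isBest p hx, count_isBest q hx]
    exact Finset.sum_congr rfl fun C _ => h C x
  · intro h C x
    by_cases hx : x ∈ C
    · have h0 : ∀ r : Preference X, upper r x ≠ C := by
        rintro r rfl
        exact self_notMem_upper r x hx
      simp [count, h0]
    · refine eq_of_sum_powerset_eq (f := fun C => count p (upper · x = C))
        (g := fun C => count q (upper · x = C)) (D := fun C => x ∉ C)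
        (fun B C hBC hC hB => hC (hBC hB)) (fun C hC => ?_) C hx
      have := h Cᶜ x (by simpa using hC)
      rwa [count_isBest p (by simpa using hC), count_isBest q (by simpa using hC),
        compl_compl] at this

/-! ### Sequences and multiplicities -/

omit [Fintype X] in
theorem sameUpToOrder_iff (p q : Fin N → Preference X) :
    SameUpToOrder p q ↔ ∀ r, count p (· = r) = count q (· = r) := by
  classical
  constructor
  · rintro ⟨π, hπ⟩ r
    exact count_eq_of_perm π fun n => by rw [hπ]
  · intro h
    refine exists_perm_of_card_fiber_eq q p fun r => ?_
    have := h r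
    simp only [count] at this
    convert this.symm

open Classical in
theorem sum_ite_count {M : Type*} [AddCommMonoidWithOne M] (p : Fin N → Preference X)
    (P : Preference X → Prop) :
    (∑ r, if P r then (count p (· = r) : M) else 0) = count p P := by
  rw [← Finset.sum_filter, ← Nat.cast_sum]
  congr 1
  unfold count
  rw [Finset.card_eq_sum_card_fiberwise (f := p) (t := Finset.univ.filter P)]
  · refine Finset.sum_congr rfl fun r hr => ?_
    congr 1
    ext n
    simp only [Finset.mem_filter, Finset.mem_univ, true_and, iff_and_self] at hr ⊢
    rintro rfl
    exact hr
  · intro n hn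
    simpa using hn

theorem exists_sequence (c : Preference X → ℕ) (hc : ∑ r, c r = N) :
    ∃ p : Fin N → Preference X, ∀ r, count p (· = r) = c r := by
  classical
  have e : (Σ r, Fin (c r)) ≃ Fin N := Fintype.equivFinOfCardEq (by simp [hc])
  refine ⟨fun n => (e.symm n).1, fun r => ?_⟩
  have e' : {n // (e.symm n).1 = r} ≃ Fin (c r) :=
    (e.symm.subtypeEquiv (q := fun a : Σ r, Fin (c r) => a.1 = r) fun _ => Iff.rfl).trans
      (Equiv.sigmaSubtype r)
  have := Fintype.card_congr e'
  rw [Fintype.card_subtype, Fintype.card_fin] at this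
  rw [← this]
  unfold count
  congr

omit [Fintype X] in
theorem mem_of_count {p : Fin N → Preference X} {S : Set (Preference X)}
    (h : ∀ r, count p (· = r) ≠ 0 → r ∈ S) (n : Fin N) : p n ∈ S := by
  classical
  refine h _ ?_
  unfold count
  exact Finset.card_ne_zero_of_mem (a := n) (by simp)

/-! ### Empirical distributions -/

/-- The empirical distribution of a sequence of preferences. -/
noncomputable def empirical (p : Fin N → Preference X) (r : Preference X) : ℝ :=
  count p (· = r) / N

theorem choiceProb_empirical (p : Fin N → Preference X) (x : X) (A : Finset X) :
    choiceProb (empirical p) x A = count p (IsBest · x A) / N := by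
  classical
  rw [← sum_ite_count (M := ℝ), Finset.sum_div]
  unfold choiceProb empirical
  refine Finset.sum_congr rfl fun r _ => ?_
  by_cases h : IsBest r x A <;> simp [h]

theorem empirical_mem_supportRestriction (hN : N ≠ 0) {p : Fin N → Preference X}
    {S : Set (Preference X)} (hp : ∀ n, p n ∈ S) : empirical p ∈ supportRestriction S := by
  classical
  refine ⟨⟨fun r => by unfold empirical; positivity, ?_⟩, fun r hr => ?_⟩
  · have := sum_ite_count (M := ℝ) p fun _ => True
    simp only [if_true] at this
    unfold empirical
    rw [← Finset.sum_div, this]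
    simp [count, hN]
  · have h0 : count p (· = r) ≠ 0 := by
      intro h
      simp [empirical, h] at hr
    obtain ⟨n, hn⟩ := Finset.card_ne_zero.1 h0
    have : p n = r := by simpa using hn
    exact this ▸ hp n

omit [Fintype X] in
theorem sameUpToOrder_of_empirical_eq (hN : N ≠ 0) {p q : Fin N → Preference X}
    (h : empirical p = empirical q) : SameUpToOrder p q := by
  rw [sameUpToOrder_iff]
  intro r
  have h1 := congrFun h r
  have hN' : (N : ℝ) ≠ 0 := by exact_mod_cast hN
  unfold empirical at h1
  rw [div_left_inj' hN'] at h1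
  exact_mod_cast h1

theorem obsEquiv_empirical {p q : Fin N → Preference X} (h : RearrangementEquivalent p q) :
    ObsEquiv (empirical p) (empirical q) := by
  intro A x hx
  rw [choiceProb_empirical, choiceProb_empirical,
    (rearrangementEquivalent_iff_count_isBest p q).1 h A x hx]

/-! ### From real to integer solutions -/

/-- A nonzero real vector can be replaced by a nonzero integer vector that vanishes wherever the
real one does and satisfies all the relations `∑ i ∈ t, d i = 0` that the real one satisfies. -/
theorem exists_int_of_real {ι : Type*} [Finite ι] {d : ι → ℝ} (hd : d ≠ 0) :
    ∃ z : ι → ℤ, z ≠ 0 ∧ (∀ i, d i = 0 → z i = 0) ∧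
      ∀ t : Finset ι, ∑ i ∈ t, d i = 0 → ∑ i ∈ t, z i = 0 := by
  obtain ⟨i₀, hi₀⟩ := Function.ne_iff.1 hd
  obtain ⟨φ, hφ⟩ : ∃ φ : Module.Dual ℚ ℝ, φ (d i₀) ≠ 0 := by
    by_contra! h
    exact hi₀ ((Module.forall_dual_apply_eq_zero_iff ℚ (d i₀)).1 h)
  obtain ⟨b, hb⟩ := IsLocalization.exist_integer_multiples_of_finite (nonZeroDivisors ℤ)
    fun i => φ (d i)
  choose z hz using hb
  have hb0 : ((b : ℤ) : ℚ) ≠ 0 := by exact_mod_cast nonZeroDivisors.coe_ne_zero b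
  have hz' : ∀ i, (z i : ℚ) = (b : ℤ) * φ (d i) := fun i => by
    have := hz i
    simpa [Algebra.smul_def] using this
  refine ⟨z, ?_, ?_, ?_⟩
  · intro h0
    have := hz' i₀
    simp [h0, hφ] at this
  · intro i hi
    have := hz' i
    rw [hi, map_zero, mul_zero] at this
    exact_mod_cast this
  · intro t ht
    have : ((∑ i ∈ t, z i : ℤ) : ℚ) = 0 := by
      rw [Int.cast_sum, Finset.sum_congr rfl fun i _ => hz' i, ← Finset.mul_sum, ← map_sum, ht,
        map_zero, mul_zero]
    exact_mod_cast this

open Classical in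
/-- An integer solution with total mass zero is the difference of the multiplicities of two
sequences, its positive and its negative part. -/
theorem exists_sequences_of_int (z : Preference X → ℤ) (hz : z ≠ 0) (hsum : ∑ r, z r = 0)
    {S : Set (Preference X)} (hS : ∀ r, z r ≠ 0 → r ∈ S)
    (hbest : ∀ (A : Finset X), ∀ x ∈ A, ∑ r ∈ Finset.univ.filter (IsBest · x A), z r = 0) :
    ∃ (N : ℕ) (p q : Fin N → Preference X), (∀ n, p n ∈ S) ∧ (∀ n, q n ∈ S) ∧
      ¬ SameUpToOrder p q ∧ RearrangementEquivalent p q := by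
  have hpm : ∀ r, (((z r).toNat : ℤ) - ((-z r).toNat : ℤ)) = z r := fun r => by omega
  have hN : ∑ r, (-z r).toNat = ∑ r, (z r).toNat := by
    have : ((∑ r, (z r).toNat : ℕ) : ℤ) - ((∑ r, (-z r).toNat : ℕ) : ℤ) = 0 := by
      rw [Nat.cast_sum, Nat.cast_sum, ← Finset.sum_sub_distrib, Finset.sum_congr rfl
        fun r _ => hpm r, hsum]
    omega
  obtain ⟨p, hp⟩ := exists_sequence (fun r => (z r).toNat) rfl
  obtain ⟨q, hq⟩ := exists_sequence (fun r => (-z r).toNat) hN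
  refine ⟨_, p, q, mem_of_count fun r hr => hS r ?_, mem_of_count fun r hr => hS r ?_, ?_, ?_⟩
  · intro h0
    simp [hp, h0] at hr
  · intro h0
    simp [hq, h0] at hr
  · rw [sameUpToOrder_iff]
    intro h
    refine hz (funext fun r => ?_)
    have h1 := h r
    rw [hp, hq] at h1
    have h2 := hpm r
    rw [h1, sub_self] at h2
    exact h2.symm
  · rw [rearrangementEquivalent_iff_count_isBest]
    intro A x hx
    have h2 : ((count p (IsBest · x A) : ℤ)) - count q (IsBest · x A) = 0 := by
      rw [← sum_ite_count, ← sum_ite_count, ← Finset.sum_filter, ← Finset.sum_filter,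
        ← Finset.sum_sub_distrib, ← hbest A x hx]
      exact Finset.sum_congr rfl fun r _ => by rw [hp, hq, hpm]
    omega

end RandomUtility

open RandomUtility in
theorem corollary1 {X : Type*} [Fintype X] (S : Set (RandomUtility.Preference X)) :
    RandomUtility.IsIdentifying (RandomUtility.supportRestriction S) ↔
      ¬ ∃ (N : ℕ) (p q : Fin N → RandomUtility.Preference X),
        (∀ n, p n ∈ S) ∧ (∀ n, q n ∈ S) ∧
        ¬ RandomUtility.SameUpToOrder p q ∧ RandomUtility.RearrangementEquivalent p q := by
  classical
  refine not_congr ⟨?_, ?_⟩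
  · rintro ⟨μ, hμ, ν, hν, hne, hobs⟩
    obtain ⟨z, hz, hz0, hzs⟩ := exists_int_of_real (sub_ne_zero.2 hne)
    refine exists_sequences_of_int z hz (hzs _ ?_) (fun r hr => ?_) fun A x hx => hzs _ ?_
    · simp [hμ.1.2, hν.1.2]
    · by_contra hrS
      have h1 : μ r = 0 := by_contra fun h => hrS (hμ.2 h)
      have h2 : ν r = 0 := by_contra fun h => hrS (hν.2 h)
      exact hr (hz0 r (by simp [h1, h2]))
    · have h := hobs A x hx
      unfold choiceProb at h
      rw [← Finset.sum_filter, ← Finset.sum_filter] at h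
      simp only [Pi.sub_apply, Finset.sum_sub_distrib]
      exact sub_eq_zero.2 h
  · rintro ⟨N, p, q, hp, hq, hne, hpq⟩
    -- The empirical distribution of the empty sequence is not a probability distribution.
    have hN : N ≠ 0 := by
      rintro rfl
      exact hne ⟨1, fun n => n.elim0⟩
    exact ⟨empirical p, empirical_mem_supportRestriction hN hp, empirical q,
      empirical_mem_supportRestriction hN hq,
      fun h => hne (sameUpToOrder_of_empirical_eq hN h), obsEquiv_empirical hpq⟩
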